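/- All vector spaces are over $\mathbb{C}$. A Lie conformal algebra is a $\mathbb{C}[\partial]$-module $R$ with a $\mathbb{C}$-bilinear $\lambda$-bracket $R\times R\to R[\lambda]$, $(a,b)\mapsto[a_\lambda b]$, such that $[\partial a_\lambda b]=-\lambda[a_\lambda b]$, $[a_\lambda\partial b]=(\partial+\lambda)[a_\lambda b]$, $[a_\lambda b]=-[b_{-\lambda-\partial}a]$ and $[a_\lambda[b_\mu c]]=[[a_\lambda b]_{\lambda+\mu}c]+[b_\mu[a_\lambda c]]$. Homomorphisms are the $\mathbb{C}[\partial]$-linear maps that preserve the $\lambda$-bracket. A central extension of $R$ is a surjective homomorphism $\pi:E\to R$ such that all $\lambda$-brackets of elements of $\ker\pi$ with elements of $E$ vanish. It is trivial if $\pi$ has a section that is a homomorphism. It is universal if for every central extension $\pi':E'\to R$ there is exactly one homomorphism $f:E\to E'$ with $\pi'f=\pi$. Two extensions of $R$ are isomorphic if there is an isomorphism of Lie conformal algebras between them that is compatible with the projections to $R$. Let $\mathcal{B}$ be the Lie conformal algebra that is the free $\mathbb{C}[\partial]$-module with basis $\{J_i\mid i\in\mathbb{Z}_{\ge 0}\}$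 and has the $\lambda$-bracket $$[J_i{}_\lambda J_j]=\big((i+1)\partial+(i+j+2)\lambda\big)J_{i+j}\qquad(i,j\ge 0).$$ Corollary. $\mathcal{B}$ has a nontrivial universal central extension $\widetilde{\mathcal{B}}=\mathcal{B}\oplus\mathbb{C}\mathfrak{c}\to\mathcal{B}$, with kernel $\mathbb{C}\mathfrak{c}\neq 0$ and $\partial\mathfrak{c}=0$, whose $\lambda$-bracket satisfies $$[J_0{}_\lambda J_0]=(\partial+2\lambda)J_0+\lambda^3\mathfrak{c},\qquad [J_i{}_\lambda J_j]=\big((i+1)\partial+(i+j+2)\lambda\big)J_{i+j}\quad\text{for all } (i,j)\neq(0,0).$$ It is unique: every universal central extension of $\mathcal{B}$ is isomorphic to $\widetilde{\mathcal{B}}$, and so is every nontrivial central extension of $\mathcal{B}$ whose kernel is one-dimensional over $\mathbb{C}$. -/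

import Mathlib

open Polynomial

universe u

noncomputable section

/-- Substitution of an operator `T` for the indeterminate: for `p = ∑ λⁿ xₙ` in `M[λ]`, the element
`∑ Tⁿ xₙ` of `M`. -/
def substOp {M : Type*} [AddCommGroup M] [Module ℂ M] (T : Module.End ℂ M) :
    PolynomialModule ℂ M →ₗ[ℂ] M :=
  (Finsupp.lsum ℂ fun n : ℕ => T ^ n).comp
    (PolynomialModule.coeffLinearEquiv ℂ ℂ).toLinearMap

/-- A Lie conformal algebra: a `ℂ[∂]`-module `R`, given as a complex vector space with the operator
`del = ∂`, together with a `ℂ`-bilinear `λ`-bracket `[a_λ b]` with values in `R[λ]`.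
The axioms are identities between polynomials in `λ` (and `μ`) with coefficients in `R`. They are
stated for all complex values `l`, `m` of the indeterminates, which is the same thing because `ℂ` is
infinite (see `polynomialModule_ext_eval`). In the skew-symmetry axiom, `-λ-∂` is substituted for the
indeterminate of `[b_λ a]`, with the powers of `∂` acting on the coefficients. -/
class LieConformalAlgebra (R : Type*) [AddCommGroup R] [Module ℂ R] where
  /-- The operator `∂`. -/
  del : R →ₗ[ℂ] R
  /-- The `λ`-bracket `a ↦ b ↦ [a_λ b]`. -/
  bracket : R →ₗ[ℂ] R →ₗ[ℂ] PolynomialModule ℂ R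
  /-- `[∂a_λ b] = -λ[a_λ b]`. -/
  sesq_left : ∀ (l : ℂ) (a b : R),
    (bracket (del a) b).eval l = -(l • (bracket a b).eval l)
  /-- `[a_λ ∂b] = (∂ + λ)[a_λ b]`. -/
  sesq_right : ∀ (l : ℂ) (a b : R),
    (bracket a (del b)).eval l = del ((bracket a b).eval l) + l • (bracket a b).eval l
  /-- `[a_λ b] = -[b_{-λ-∂} a]`. -/
  skew : ∀ (l : ℂ) (a b : R),
    (bracket a b).eval l = -substOp (-(l • (1 : Module.End ℂ R)) - del) (bracket b a)
  /-- `[a_λ [b_μ c]] = [[a_λ b]_{λ+μ} c] + [b_μ [a_λ c]]`. -/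
  jacobi : ∀ (l m : ℂ) (a b c : R),
    (bracket a ((bracket b c).eval m)).eval l =
      (bracket ((bracket a b).eval l) c).eval (l + m) + (bracket b ((bracket a c).eval l)).eval m

namespace LieConformalAlgebra

/-- `∂a`. -/
abbrev partialD {R : Type*} [AddCommGroup R] [Module ℂ R] [LieConformalAlgebra R] (a : R) : R :=
  del a

/-- The `λ`-bracket `[a_λ b]`, as an element of `R[λ]`. -/
abbrev lamBracket {R : Type*} [AddCommGroup R] [Module ℂ R] [LieConformalAlgebra R] (a b : R) :
    PolynomialModule ℂ R :=
  bracket a b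

/-- Homomorphisms of Lie conformal algebras: `ℂ[∂]`-linear maps that preserve the `λ`-bracket. -/
structure Hom (R S : Type*) [AddCommGroup R] [Module ℂ R] [LieConformalAlgebra R]
    [AddCommGroup S] [Module ℂ S] [LieConformalAlgebra S] where
  toLin : R →ₗ[ℂ] S
  map_del : ∀ a, toLin (partialD a) = partialD (toLin a)
  map_bracket : ∀ a b,
    lamBracket (toLin a) (toLin b) = PolynomialModule.map ℂ toLin (lamBracket a b)

/-- `π : E → R` is a central extension of `R`: a surjective homomorphism whose kernel lies in the
center of `E`. -/
def IsCentralExtension {E R : Type*} [AddCommGroup E] [Module ℂ E] [LieConformalAlgebra E]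
    [AddCommGroup R] [Module ℂ R] [LieConformalAlgebra R] (π : Hom E R) : Prop :=
  Function.Surjective π.toLin ∧
    ∀ z : E, π.toLin z = 0 → ∀ a : E, lamBracket z a = 0 ∧ lamBracket a z = 0

/-- The extension `π : E → R` is trivial (split): some homomorphism `R → E` is a section of it. -/
def IsTrivialExtension {E R : Type*} [AddCommGroup E] [Module ℂ E] [LieConformalAlgebra E]
    [AddCommGroup R] [Module ℂ R] [LieConformalAlgebra R] (π : Hom E R) : Prop :=
  ∃ s : Hom R E, ∀ x : R, π.toLin (s.toLin x) = x

/-- `π : E → R` is a universal central extension of `R`: it is a central extension, and to every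
central extension `π' : E' → R` (with `E'` in the universe `w`) there is exactly one homomorphism
`E → E'` over `R`. -/
def IsUniversalCentralExtension.{w, v₁, v₂} {E : Type v₁} {R : Type v₂}
    [AddCommGroup E] [Module ℂ E] [LieConformalAlgebra E]
    [AddCommGroup R] [Module ℂ R] [LieConformalAlgebra R] (π : Hom E R) : Prop :=
  IsCentralExtension π ∧
    ∀ (E' : Type w) [AddCommGroup E'] [Module ℂ E'] [LieConformalAlgebra E'] (π' : Hom E' R),
      IsCentralExtension π' → ∃! f : Hom E E', ∀ x : E, π'.toLin (f.toLin x) = π.toLin x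

/-- Two extensions of `R` are isomorphic (over `R`). -/
def ExtensionIso {E E' R : Type*} [AddCommGroup E] [Module ℂ E] [LieConformalAlgebra E]
    [AddCommGroup E'] [Module ℂ E'] [LieConformalAlgebra E']
    [AddCommGroup R] [Module ℂ R] [LieConformalAlgebra R] (π : Hom E R) (π' : Hom E' R) : Prop :=
  ∃ f : Hom E E', Function.Bijective f.toLin ∧ ∀ x : E, π'.toLin (f.toLin x) = π.toLin x

end LieConformalAlgebra

/-! ### Helper facts on `M[λ]` -/

section helpers

variable {M : Type*} [AddCommGroup M] [Module ℂ M]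

/-- Multiplication by `λ` on `M[λ]`. -/
def mulLam (M : Type*) [AddCommGroup M] [Module ℂ M] : Module.End ℂ (PolynomialModule ℂ M) :=
  Algebra.lsmul ℂ ℂ (PolynomialModule ℂ M) (X : ℂ[X])

theorem mulLam_single (n : ℕ) (x : M) :
    mulLam M (PolynomialModule.single ℂ n x) = PolynomialModule.single ℂ (n + 1) x := by
  simp [mulLam, ← monomial_one_one_eq_X, add_comm]

theorem substOp_single (T : Module.End ℂ M) (n : ℕ) (x : M) :
    substOp T (PolynomialModule.single ℂ n x) = (T ^ n) x := by
  simp [substOp]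

theorem eval_eq_substOp (l : ℂ) (p : PolynomialModule ℂ M) :
    p.eval l = substOp (l • (1 : Module.End ℂ M)) p := by
  induction p using PolynomialModule.induction_linear with
  | zero => simp
  | add p q hp hq => simp only [map_add, hp, hq]
  | single n x => simp [substOp_single, _root_.smul_pow]

/-- Elements of `M[λ]` that agree at all complex values of `λ` are equal. -/
theorem polynomialModule_ext_eval {p q : PolynomialModule ℂ M}
    (h : ∀ l : ℂ, p.eval l = q.eval l) : p = q := by
  rw [← sub_eq_zero]
  have h' : ∀ l : ℂ, (p - q).eval l = 0 := fun l => by rw [map_sub, h, sub_self]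
  generalize p - q = r at h'
  ext n
  rw [PolynomialModule.coeff_zero, Finsupp.zero_apply, ← Module.forall_dual_apply_eq_zero_iff ℂ]
  intro φ
  have key : ∀ (s : PolynomialModule ℂ M) (l : ℂ),
      ((PolynomialModule.equivPolynomial (PolynomialModule.map ℂ φ s)) : ℂ[X]).eval l
        = φ (s.eval l) := by
    intro s l
    induction s using PolynomialModule.induction_linear with
    | zero => simp
    | add p q hp hq => simp only [map_add, Polynomial.eval_add, hp, hq]
    | single n x => simp [mul_comm]
  have h0 : (PolynomialModule.equivPolynomial (PolynomialModule.map ℂ φ r) : ℂ[X]) = 0 :=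
    Polynomial.funext fun l => by rw [key, h', map_zero, Polynomial.eval_zero]
  have h1 : PolynomialModule.map ℂ φ r = 0 := by simpa using h0
  have h2 := congrArg (fun s => PolynomialModule.coeff s n) h1
  simpa [PolynomialModule.map] using h2

theorem substOp_mulLam (T : Module.End ℂ M) (p : PolynomialModule ℂ M) :
    substOp T (mulLam M p) = T (substOp T p) := by
  induction p using PolynomialModule.induction_linear with
  | zero => simp
  | add p q hp hq => simp only [map_add, hp, hq]
  | single n x => simp [mulLam_single, substOp_single, pow_succ']

theorem substOp_map (T D : Module.End ℂ M) (h : Commute T D) (p : PolynomialModule ℂ M) :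
    substOp T (PolynomialModule.map ℂ D p) = D (substOp T p) := by
  induction p using PolynomialModule.induction_linear with
  | zero => simp
  | add p q hp hq => simp only [map_add, hp, hq]
  | single n x =>
    simpa [substOp_single] using congrArg (fun S => S x) (h.pow_left n).eq

theorem aeval_intertwine {N : Type*} [AddCommGroup N] [Module ℂ N] (φ : M →ₗ[ℂ] N)
    (T : Module.End ℂ M) (S : Module.End ℂ N) (h : ∀ x, φ (T x) = S (φ x)) (f : ℂ[X]) (x : M) :
    φ (aeval T f x) = aeval S f (φ x) := by
  induction f using Polynomial.induction_on' generalizing x with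
  | add p q hp hq => simp [hp, hq]
  | monomial n a =>
    have : ∀ (n : ℕ) (x : M), φ ((T ^ n) x) = (S ^ n) (φ x) := by
      intro n
      induction n with
      | zero => simp
      | succ n ih => intro x; simp [pow_succ, ih, h]
    simp [aeval_monomial, this]

theorem aeval_smul_one (c : ℂ) (f : ℂ[X]) (x : M) :
    aeval (c • (1 : Module.End ℂ M)) f x = f.eval c • x := by
  induction f using Polynomial.induction_on' with
  | add p q hp hq => simp [hp, hq, add_smul]
  | monomial n a => simp [aeval_monomial, _root_.smul_pow, smul_smul, mul_comm]

end helpers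

/-! ### The Lie conformal algebra of Block type -/

/-- The free `ℂ[∂]`-module with basis `J₀, J₁, J₂, …`; here `X` is `∂`. -/
abbrev Block : Type := ℕ →₀ ℂ[X]

namespace Block

/-- The generators `J_i`. -/
def J (i : ℕ) : Block := Finsupp.single i 1

/-- The operator `∂`: multiplication by `X`. -/
def del : Module.End ℂ Block := Algebra.lsmul ℂ ℂ Block (X : ℂ[X])

/-- The extension by sesquilinearity of a bracket `w i j` prescribed on the generators, with values
in `M[λ]` where `∂` acts on `M` by `D`:
`[f(∂)J_i _λ g(∂)J_j] = f(-λ) g(∂ + λ) (w i j)`, extended additively. -/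
def sesqExt {M : Type*} [AddCommGroup M] [Module ℂ M] (D : Module.End ℂ M)
    (w : ℕ → ℕ → PolynomialModule ℂ M) : Block →ₗ[ℂ] Block →ₗ[ℂ] PolynomialModule ℂ M :=
  LinearMap.mk₂ ℂ
    (fun a b => a.sum fun i f => b.sum fun j g =>
      aeval (-mulLam M) f (aeval (PolynomialModule.map ℂ D + mulLam M) g (w i j)))
    (fun a a' b => Finsupp.sum_add_index' (by simp)
      (by intro i f f'; simp [Finsupp.sum_add]))
    (fun c a b => by
      rw [Finsupp.sum_smul_index' (by simp), Finsupp.smul_sum]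
      simp [Finsupp.smul_sum])
    (fun a b b' => by
      rw [← Finsupp.sum_add]
      refine Finsupp.sum_congr fun i _ => Finsupp.sum_add_index' (by simp) (by simp))
    (fun c a b => by
      rw [Finsupp.smul_sum]
      refine Finsupp.sum_congr fun i _ => ?_
      rw [Finsupp.sum_smul_index' (by simp), Finsupp.smul_sum]
      simp)

theorem sesqExt_single {M : Type*} [AddCommGroup M] [Module ℂ M] (D : Module.End ℂ M)
    (w : ℕ → ℕ → PolynomialModule ℂ M) (i j : ℕ) (f g : ℂ[X]) :
    sesqExt D w (Finsupp.single i f) (Finsupp.single j g) =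
      aeval (-mulLam M) f (aeval (PolynomialModule.map ℂ D + mulLam M) g (w i j)) := by
  simp [sesqExt]

/-- `[J_i _λ J_j] = ((i+1)∂ + (i+j+2)λ) J_{i+j}`. -/
def genBracket (i j : ℕ) : PolynomialModule ℂ Block :=
  PolynomialModule.single ℂ 0 (((i : ℂ) + 1) • del (J (i + j))) +
    PolynomialModule.single ℂ 1 (((i : ℂ) + j + 2) • J (i + j))

theorem del_single (i : ℕ) (f : ℂ[X]) :
    del (Finsupp.single i f) = Finsupp.single i (X * f) := by
  simp [del]

theorem J_eq (i : ℕ) (c : ℂ) : c • J i = Finsupp.single i (C c) := by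
  simp [J, Polynomial.smul_eq_C_mul]

/-- A statement that is additive in an element of `Block` only has to be checked on `f(∂) J_i`. -/
theorem lin_ext {N : Type*} [AddCommGroup N] [Module ℂ N] {φ ψ : Block →ₗ[ℂ] N}
    (h : ∀ i f, φ (Finsupp.single i f) = ψ (Finsupp.single i f)) (a : Block) : φ a = ψ a := by
  induction a using Finsupp.induction_linear with
  | zero => simp
  | add a b ha hb => simp only [map_add, ha, hb]
  | single i f => exact h i f

section sesq

variable {M : Type*} [AddCommGroup M] [Module ℂ M] (D : Module.End ℂ M)
  (w : ℕ → ℕ → PolynomialModule ℂ M)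

theorem eval_sesqExt_single (l : ℂ) (i j : ℕ) (f g : ℂ[X]) :
    (sesqExt D w (Finsupp.single i f) (Finsupp.single j g)).eval l =
      f.eval (-l) • aeval (D + l • (1 : Module.End ℂ M)) g ((w i j).eval l) := by
  have h1 : ∀ x : PolynomialModule ℂ M,
      PolynomialModule.eval l ((-mulLam M) x) =
        ((-l) • (1 : Module.End ℂ M)) (PolynomialModule.eval l x) := by
    intro x
    simp [eval_eq_substOp, substOp_mulLam]
  have h2 : ∀ x : PolynomialModule ℂ M,
      PolynomialModule.eval l ((PolynomialModule.map ℂ D + mulLam M) x) =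
        (D + l • (1 : Module.End ℂ M)) (PolynomialModule.eval l x) := by
    intro x
    have hc : Commute (l • (1 : Module.End ℂ M)) D := (Commute.one_left D).smul_left l
    simp [eval_eq_substOp, substOp_mulLam, substOp_map _ D hc]
  rw [sesqExt_single, aeval_intertwine _ _ _ h1, aeval_intertwine _ _ _ h2, aeval_smul_one]

theorem subst_sesqExt_single (l : ℂ) (i j : ℕ) (f g : ℂ[X]) :
    substOp (-(l • (1 : Module.End ℂ M)) - D)
      (sesqExt D w (Finsupp.single i f) (Finsupp.single j g)) =
      aeval (D + l • (1 : Module.End ℂ M)) f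
        (g.eval (-l) • substOp (-(l • (1 : Module.End ℂ M)) - D) (w i j)) := by
  have hc : Commute (-(l • (1 : Module.End ℂ M)) - D) D :=
    (((Commute.one_left D).smul_left l).neg_left).sub_left (Commute.refl D)
  have h1 : ∀ x : PolynomialModule ℂ M,
      substOp (-(l • (1 : Module.End ℂ M)) - D) ((-mulLam M) x) =
        (D + l • (1 : Module.End ℂ M)) (substOp (-(l • (1 : Module.End ℂ M)) - D) x) := by
    intro x
    simp [substOp_mulLam]
  have h2 : ∀ x : PolynomialModule ℂ M,
      substOp (-(l • (1 : Module.End ℂ M)) - D) ((PolynomialModule.map ℂ D + mulLam M) x) =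
        ((-l) • (1 : Module.End ℂ M)) (substOp (-(l • (1 : Module.End ℂ M)) - D) x) := by
    intro x
    simp [substOp_mulLam, substOp_map _ D hc]
  rw [sesqExt_single, aeval_intertwine _ _ _ h1, aeval_intertwine _ _ _ h2, aeval_smul_one]

theorem sesqExt_left (l : ℂ) (a b : Block) :
    (sesqExt D w (del a) b).eval l = -(l • (sesqExt D w a b).eval l) := by
  refine lin_ext
    (φ := (PolynomialModule.eval l).comp ((sesqExt D w).flip b |>.comp del))
    (ψ := -(l • (PolynomialModule.eval l).comp ((sesqExt D w).flip b))) (fun i f => ?_) a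
  refine lin_ext
    (φ := (PolynomialModule.eval l).comp (sesqExt D w (del (Finsupp.single i f))))
    (ψ := -(l • (PolynomialModule.eval l).comp (sesqExt D w (Finsupp.single i f))))
    (fun j g => ?_) b
  have e : eval (-l) (X * f) = -(l * eval (-l) f) := by simp
  simp only [LinearMap.comp_apply, LinearMap.neg_apply, LinearMap.smul_apply, del_single,
    eval_sesqExt_single, e, neg_smul, mul_smul]

theorem sesqExt_right (l : ℂ) (a b : Block) :
    (sesqExt D w a (del b)).eval l =
      D ((sesqExt D w a b).eval l) + l • (sesqExt D w a b).eval l := by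
  refine lin_ext
    (φ := (PolynomialModule.eval l).comp ((sesqExt D w).flip (del b)))
    (ψ := D.comp ((PolynomialModule.eval l).comp ((sesqExt D w).flip b)) +
      l • (PolynomialModule.eval l).comp ((sesqExt D w).flip b)) (fun i f => ?_) a
  refine lin_ext
    (φ := (PolynomialModule.eval l).comp ((sesqExt D w (Finsupp.single i f)).comp del))
    (ψ := D.comp ((PolynomialModule.eval l).comp (sesqExt D w (Finsupp.single i f))) +
      l • (PolynomialModule.eval l).comp (sesqExt D w (Finsupp.single i f)))
    (fun j g => ?_) b
  simp only [LinearMap.comp_apply, LinearMap.add_apply, LinearMap.smul_apply, del_single,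
    eval_sesqExt_single, map_mul, aeval_X, Module.End.mul_apply, map_smul, Module.End.one_apply,
    smul_add]
  rw [smul_comm l]

theorem sesqExt_skew (l : ℂ)
    (hw : ∀ i j, (w i j).eval l = -substOp (-(l • (1 : Module.End ℂ M)) - D) (w j i))
    (a b : Block) :
    (sesqExt D w a b).eval l =
      -substOp (-(l • (1 : Module.End ℂ M)) - D) (sesqExt D w b a) := by
  refine lin_ext
    (φ := (PolynomialModule.eval l).comp ((sesqExt D w).flip b))
    (ψ := -(substOp (-(l • (1 : Module.End ℂ M)) - D)).comp (sesqExt D w b)) (fun i f => ?_) a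
  refine lin_ext
    (φ := (PolynomialModule.eval l).comp (sesqExt D w (Finsupp.single i f)))
    (ψ := -(substOp (-(l • (1 : Module.End ℂ M)) - D)).comp
      ((sesqExt D w).flip (Finsupp.single i f))) (fun j g => ?_) b
  simp [eval_sesqExt_single, subst_sesqExt_single, hw i j]

end sesq

theorem aeval_del (l : ℂ) (g p : ℂ[X]) (i : ℕ) :
    aeval (del + l • (1 : Module.End ℂ Block)) g (Finsupp.single i p) =
      Finsupp.single i (g.comp (X + C l) * p) := by
  induction g using Polynomial.induction_on' with
  | add p q hp hq => simp [hp, hq, add_mul]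
  | monomial n a =>
    have : ∀ n : ℕ, ((del + l • (1 : Module.End ℂ Block)) ^ n) (Finsupp.single i p) =
        Finsupp.single i ((X + C l) ^ n * p) := by
      intro n
      induction n with
      | zero => simp
      | succ n ih =>
        rw [pow_succ', Module.End.mul_apply, ih]
        simp only [LinearMap.add_apply, LinearMap.smul_apply, Module.End.one_apply, del_single,
          Finsupp.smul_single, ← Finsupp.single_add, Polynomial.smul_eq_C_mul]
        ring_nf
    simp [aeval_monomial, this, Polynomial.smul_eq_C_mul, mul_assoc, -Finsupp.single_mul]

theorem eval_genBracket (l : ℂ) (i j : ℕ) :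
    (genBracket i j).eval l =
      Finsupp.single (i + j) (C ((i : ℂ) + 1) * X + C (((i : ℂ) + j + 2) * l)) := by
  simp only [genBracket, map_add, PolynomialModule.eval_single, J, del_single,
    Finsupp.smul_single, ← Finsupp.single_add, Polynomial.smul_eq_C_mul]
  congr 1
  simp only [map_mul, map_add, map_one, map_ofNat C, pow_zero, pow_one]
  ring

/-- `[f(∂)J_i _λ g(∂)J_j] = f(-λ) g(∂+λ) ((i+1)∂ + (i+j+2)λ) J_{i+j}`. -/
theorem eval_bracket_single (l : ℂ) (i j : ℕ) (f g : ℂ[X]) :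
    (sesqExt del genBracket (Finsupp.single i f) (Finsupp.single j g)).eval l =
      Finsupp.single (i + j) (C (f.eval (-l)) *
        (g.comp (X + C l) * (C ((i : ℂ) + 1) * X + C (((i : ℂ) + j + 2) * l)))) := by
  rw [eval_sesqExt_single, eval_genBracket, aeval_del]
  simp only [Finsupp.smul_single, Polynomial.smul_eq_C_mul]

/-- Trilinear identities only have to be checked on `f(∂)J_i`, `g(∂)J_j`, `h(∂)J_k`. -/
theorem trilin_ext {N : Type*} [AddCommGroup N] [Module ℂ N]
    {φ ψ : Block →ₗ[ℂ] Block →ₗ[ℂ] Block →ₗ[ℂ] N}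
    (h : ∀ i j k f g h, φ (Finsupp.single i f) (Finsupp.single j g) (Finsupp.single k h) =
      ψ (Finsupp.single i f) (Finsupp.single j g) (Finsupp.single k h)) (a b c : Block) :
    φ a b c = ψ a b c := by
  have : φ a = ψ a := lin_ext (fun i f => LinearMap.ext fun b => lin_ext (fun j g =>
    LinearMap.ext fun c => lin_ext (fun k h' => h i j k f g h') c) b) a
  rw [this]

/-- The bracket at the complex number `l`, as a bilinear map. -/
def brAt (l : ℂ) : Block →ₗ[ℂ] Block →ₗ[ℂ] Block :=
  (sesqExt del genBracket).compr₂ (PolynomialModule.eval l)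

theorem brAt_jacobi (l m : ℂ) (a b c : Block) :
    brAt l a (brAt m b c) = brAt (l + m) (brAt l a b) c + brAt m b (brAt l a c) := by
  let φ : Block →ₗ[ℂ] Block →ₗ[ℂ] Block →ₗ[ℂ] Block :=
    LinearMap.mk₂ ℂ (fun a b => (brAt l a).comp (brAt m b))
      (by intros; refine LinearMap.ext fun x => ?_; simp)
      (by intros; refine LinearMap.ext fun x => ?_; simp)
      (by intros; refine LinearMap.ext fun x => ?_; simp)
      (by intros; refine LinearMap.ext fun x => ?_; simp)
  let ψ : Block →ₗ[ℂ] Block →ₗ[ℂ] Block →ₗ[ℂ] Block :=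
    LinearMap.mk₂ ℂ (fun a b => brAt (l + m) (brAt l a b) + (brAt m b).comp (brAt l a))
      (by intros; refine LinearMap.ext fun x => ?_; simp; abel)
      (by intros; refine LinearMap.ext fun x => ?_; simp)
      (by intros; refine LinearMap.ext fun x => ?_; simp; abel)
      (by intros; refine LinearMap.ext fun x => ?_; simp)
  refine trilin_ext (φ := φ) (ψ := ψ) (fun i j k f g h => ?_) a b c
  simp only [φ, ψ, LinearMap.mk₂_apply, LinearMap.comp_apply, LinearMap.add_apply, brAt,
    LinearMap.compr₂_apply, eval_bracket_single]
  rw [show j + (i + k) = i + (j + k) by ring, show i + j + k = i + (j + k) by ring,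
    ← Finsupp.single_add]
  congr 1
  have e : (X + C m + C l : ℂ[X]) = X + (C l + C m) := by ring
  have e' : (X + C l + C m : ℂ[X]) = X + (C l + C m) := by ring
  simp [Polynomial.comp_assoc, e, e', map_ofNat C]
  ring

theorem genBracket_skew (l : ℂ) (i j : ℕ) :
    (genBracket i j).eval l =
      -substOp (-(l • (1 : Module.End ℂ Block)) - del) (genBracket j i) := by
  rw [eval_genBracket]
  simp only [genBracket, map_add, substOp_single, J, del_single, pow_zero, pow_one,
    Module.End.one_apply, LinearMap.sub_apply, LinearMap.neg_apply, LinearMap.smul_apply,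
    Finsupp.smul_single, ← Finsupp.single_add, ← Finsupp.single_sub, ← Finsupp.single_neg,
    Polynomial.smul_eq_C_mul, add_comm j i]
  congr 1
  simp only [map_mul, map_add, map_one, map_ofNat C]
  ring

/-- The Lie conformal algebra of Block type. -/
instance : LieConformalAlgebra Block where
  del := del
  bracket := sesqExt del genBracket
  sesq_left l a b := sesqExt_left del genBracket l a b
  sesq_right l a b := sesqExt_right del genBracket l a b
  skew l a b := sesqExt_skew del genBracket l (genBracket_skew l) a b
  jacobi l m a b c := brAt_jacobi l m a b c

end Block

/-! ### Its central extension -/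

/-- The vector space `Block ⊕ ℂ𝔠`. -/
abbrev BlockExt : Type := Block × ℂ

namespace BlockExt

/-- The generators `J_i`. -/
def J (i : ℕ) : BlockExt := (Block.J i, 0)

/-- The element `𝔠`. -/
def c : BlockExt := (0, 1)

/-- The operator `∂`, with `∂𝔠 = 0`. -/
def del : Module.End ℂ BlockExt := LinearMap.prodMap Block.del 0

/-- `[J_i _λ J_j] = ((i+1)∂ + (i+j+2)λ) J_{i+j}`, with the term `λ³𝔠` added for `i = j = 0`. -/
def genBracket (i j : ℕ) : PolynomialModule ℂ BlockExt :=
  PolynomialModule.single ℂ 0 (((i : ℂ) + 1) • del (J (i + j))) +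
    PolynomialModule.single ℂ 1 (((i : ℂ) + j + 2) • J (i + j)) +
    if i = 0 ∧ j = 0 then PolynomialModule.single ℂ 3 c else 0

/-- The `λ`-bracket: the sesquilinear extension of `genBracket`, with `𝔠` central. -/
def bracket : BlockExt →ₗ[ℂ] BlockExt →ₗ[ℂ] PolynomialModule ℂ BlockExt :=
  (Block.sesqExt del genBracket).compl₁₂ (LinearMap.fst ℂ Block ℂ) (LinearMap.fst ℂ Block ℂ)

theorem genBracket_eq (i j : ℕ) :
    genBracket i j = PolynomialModule.map ℂ (LinearMap.inl ℂ Block ℂ) (Block.genBracket i j) +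
      if i = 0 ∧ j = 0 then PolynomialModule.single ℂ 3 c else 0 := by
  simp [genBracket, Block.genBracket, J, del]

theorem map_inl_eval (l : ℂ) (p : PolynomialModule ℂ Block) :
    (PolynomialModule.map ℂ (LinearMap.inl ℂ Block ℂ) p).eval l = (p.eval l, 0) := by
  induction p using PolynomialModule.induction_linear with
  | zero => simp only [map_zero]; rfl
  | add p q hp hq => simp only [map_add, hp, hq]; simp
  | single n x => simp

theorem map_inl_subst (l : ℂ) (p : PolynomialModule ℂ Block) :
    substOp (-(l • (1 : Module.End ℂ BlockExt)) - del)
      (PolynomialModule.map ℂ (LinearMap.inl ℂ Block ℂ) p) =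
      (substOp (-(l • (1 : Module.End ℂ Block)) - Block.del) p, 0) := by
  induction p using PolynomialModule.induction_linear with
  | zero => simp only [map_zero]; rfl
  | add p q hp hq => simp only [map_add, hp, hq]; simp
  | single n x =>
    simp only [PolynomialModule.map_single, substOp_single]
    induction n with
    | zero => simp
    | succ n ih =>
      rw [pow_succ', Module.End.mul_apply, ih, pow_succ', Module.End.mul_apply]
      simp [del]

theorem genBracket_skew (l : ℂ) (i j : ℕ) :
    (genBracket i j).eval l =
      -substOp (-(l • (1 : Module.End ℂ BlockExt)) - del) (genBracket j i) := by
  rw [genBracket_eq, genBracket_eq, map_add, map_add, map_inl_eval, map_inl_subst,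
    Block.genBracket_skew]
  by_cases h : i = 0 ∧ j = 0
  · obtain ⟨rfl, rfl⟩ := h
    simp [substOp_single, c, del, pow_succ, mul_assoc]
  · simp [h, and_comm]

theorem aeval_fst (l : ℂ) (g : ℂ[X]) (x : BlockExt) :
    (aeval (del + l • (1 : Module.End ℂ BlockExt)) g x).1 =
      aeval (Block.del + l • (1 : Module.End ℂ Block)) g x.1 :=
  aeval_intertwine (LinearMap.fst ℂ Block ℂ) _ _ (by intro x; simp [del]) g x

theorem aeval_snd (l : ℂ) (g : ℂ[X]) (x : BlockExt) :
    (aeval (del + l • (1 : Module.End ℂ BlockExt)) g x).2 = g.eval l * x.2 := by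
  rw [← smul_eq_mul, ← aeval_smul_one]
  exact aeval_intertwine (LinearMap.snd ℂ Block ℂ) _ _ (by intro x; simp [del]) g x

theorem eval_genBracket (l : ℂ) (i j : ℕ) :
    (genBracket i j).eval l =
      ((Block.genBracket i j).eval l, if i = 0 ∧ j = 0 then l ^ 3 else 0) := by
  rw [genBracket_eq, map_add, map_inl_eval]
  split_ifs <;> simp [c]

/-- The scalar part of the bracket at the complex number `l`. -/
def coc (l : ℂ) : Block →ₗ[ℂ] Block →ₗ[ℂ] ℂ :=
  (Block.sesqExt del genBracket).compr₂
    ((LinearMap.snd ℂ Block ℂ).comp (PolynomialModule.eval l))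

theorem coc_single (l : ℂ) (i j : ℕ) (f g : ℂ[X]) :
    coc l (Finsupp.single i f) (Finsupp.single j g) =
      f.eval (-l) * (g.eval l * if i = 0 ∧ j = 0 then l ^ 3 else 0) := by
  simp [coc, Block.eval_sesqExt_single, aeval_snd, eval_genBracket]

theorem eval_bracket (l : ℂ) (a b : BlockExt) :
    (bracket a b).eval l = (Block.brAt l a.1 b.1, coc l a.1 b.1) := by
  refine Prod.ext ?_ rfl
  change ((Block.sesqExt del genBracket a.1 b.1).eval l).1 = Block.brAt l a.1 b.1
  generalize a.1 = a
  generalize b.1 = b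
  refine Block.lin_ext
    (φ := ((LinearMap.fst ℂ Block ℂ).comp (PolynomialModule.eval l)).comp
      ((Block.sesqExt del genBracket).flip b))
    (ψ := (Block.brAt l).flip b) (fun i f => ?_) a
  refine Block.lin_ext
    (φ := ((LinearMap.fst ℂ Block ℂ).comp (PolynomialModule.eval l)).comp
      (Block.sesqExt del genBracket (Finsupp.single i f)))
    (ψ := Block.brAt l (Finsupp.single i f)) (fun j g => ?_) b
  simp [Block.brAt, Block.eval_sesqExt_single, aeval_fst, eval_genBracket]

theorem coc_jacobi (l m : ℂ) (a b c : Block) :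
    coc l a (Block.brAt m b c) =
      coc (l + m) (Block.brAt l a b) c + coc m b (Block.brAt l a c) := by
  let φ : Block →ₗ[ℂ] Block →ₗ[ℂ] Block →ₗ[ℂ] ℂ :=
    LinearMap.mk₂ ℂ (fun a b => (coc l a).comp (Block.brAt m b))
      (by intros; refine LinearMap.ext fun x => ?_; simp)
      (by intros; refine LinearMap.ext fun x => ?_; simp)
      (by intros; refine LinearMap.ext fun x => ?_; simp)
      (by intros; refine LinearMap.ext fun x => ?_; simp)
  let ψ : Block →ₗ[ℂ] Block →ₗ[ℂ] Block →ₗ[ℂ] ℂ :=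
    LinearMap.mk₂ ℂ (fun a b => coc (l + m) (Block.brAt l a b) + (coc m b).comp (Block.brAt l a))
      (by intros; refine LinearMap.ext fun x => ?_; simp; abel)
      (by intros; refine LinearMap.ext fun x => ?_; simp)
      (by intros; refine LinearMap.ext fun x => ?_; simp; abel)
      (by intros; refine LinearMap.ext fun x => ?_; simp)
  refine Block.trilin_ext (φ := φ) (ψ := ψ) (fun i j k f g h => ?_) a b c
  simp only [φ, ψ, LinearMap.mk₂_apply, LinearMap.comp_apply, LinearMap.add_apply, Block.brAt,
    LinearMap.compr₂_apply, Block.eval_bracket_single, coc_single]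
  by_cases hi : i = 0
  · by_cases hj : j = 0
    · by_cases hk : k = 0
      · subst hi hj hk
        simp [add_comm m l]
        ring
      · simp [hi, hj, hk]
    · simp [hi, hj]
  · simp [hi]

/-- The Lie conformal algebra `Block ⊕ ℂ𝔠`. -/
instance : LieConformalAlgebra BlockExt where
  del := del
  bracket := bracket
  sesq_left l a b := Block.sesqExt_left del genBracket l a.1 b.1
  sesq_right l a b := Block.sesqExt_right del genBracket l a.1 b.1
  skew l a b := Block.sesqExt_skew del genBracket l (genBracket_skew l) a.1 b.1
  jacobi l m a b c := by
    simp only [eval_bracket]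
    exact Prod.ext (Block.brAt_jacobi l m a.1 b.1 c.1) (coc_jacobi l m a.1 b.1 c.1)

/-- The projection `Block ⊕ ℂ𝔠 → Block`. -/
def proj : LieConformalAlgebra.Hom BlockExt Block where
  toLin := LinearMap.fst ℂ Block ℂ
  map_del _ := rfl
  map_bracket a b := polynomialModule_ext_eval fun l => by
    have h : ∀ p : PolynomialModule ℂ BlockExt,
        (PolynomialModule.map ℂ (LinearMap.fst ℂ Block ℂ) p).eval l = (p.eval l).1 := by
      intro p
      induction p using PolynomialModule.induction_linear with
      | zero => simp
      | add p q hp hq => simp only [map_add, hp, hq]; simp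
      | single n x => simp
    rw [h]
    exact (congrArg Prod.fst (eval_bracket l a b)).symm

end BlockExt

end

/-! The only obstruction to lifting the brackets of `Block` to a central extension `E` is a multiple
of the Virasoro cocycle `λ³` on `J_0`. Choose lifts `x_n` of the `J_n` and let `d_ij(λ)` be the
error in the bracket of `x_i` and `x_j`. It has values in the kernel, which is central, so the
Jacobi identity becomes a linear functional equation for the `d_ij` (`defect_cocycle`). The operator
`∂` need not vanish on the kernel, so it stays in this equation.

Specializing to `i = 0`, `λ = 0` expresses every `∂ d_jk` through `d_{0,j+k}(0)`. Hence correcting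
`x_n` by a multiple of the linear coefficient of `d_0n` makes all errors `∂`-invariant and removes
the linear terms of the `d_0n` (`exists_normalized_lift`). After that, `d_jk` depends only on `j +
k`. On proportional arguments the cocycle equation compares dilates of a single polynomial, and
coefficients then show that `d_jk = 0` for `j + k > 0` and that `d_00` is a cubic monomial `λ³κ`.

So `E` contains lifts with the relations of `BlockExt`, `κ` replacing `𝔠`. This gives a homomorphism
from `BlockExt` over `Block` (`exists_hom`). It is the only one because the coefficients of brackets
in `BlockExt` span it (`hom_unique`). A one-dimensional kernel leaves two cases: either `𝔠` maps to
zero and the extension splits, or the homomorphism is bijective. -/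

noncomputable section

/-! ### Polynomials with vector coefficients: evaluation, coefficients, dilation -/

section polynomialModule

variable {M N : Type*} [AddCommGroup M] [Module ℂ M] [AddCommGroup N] [Module ℂ N]

theorem eval_map_linear (φ : M →ₗ[ℂ] N) (l : ℂ) (p : PolynomialModule ℂ M) :
    (PolynomialModule.map ℂ φ p).eval l = φ (p.eval l) :=
  PolynomialModule.eval_map ℂ φ p l

theorem coeff_map_linear (φ : M →ₗ[ℂ] N) (n : ℕ) (p : PolynomialModule ℂ M) :
    (PolynomialModule.map ℂ φ p).coeff n = φ (p.coeff n) := by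
  simp [PolynomialModule.map]

theorem coeff_smul_polynomialModule (c : ℂ) (n : ℕ) (p : PolynomialModule ℂ M) :
    (c • p).coeff n = c • p.coeff n :=
  congrArg (fun q : ℕ →₀ M => q n) (map_smul (PolynomialModule.coeffLinearEquiv ℂ ℂ) c p)

/-- Elements of `M[λ]` that agree at all complex values of `λ` after multiplication by `λ` are
equal. -/
theorem polynomialModule_ext_smul_eval {p q : PolynomialModule ℂ M}
    (h : ∀ l : ℂ, l • p.eval l = l • q.eval l) : p = q := by
  have h1 : (X : ℂ[X]) • p = (X : ℂ[X]) • q :=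
    polynomialModule_ext_eval fun l => by simpa using h l
  ext n
  have h2 := congrArg (fun r => r.coeff (n + 1)) h1
  simpa [← monomial_one_one_eq_X, PolynomialModule.monomial_smul_apply] using h2

/-- The dilation `p(λ) ↦ p(rλ)` of `M[λ]`. -/
def dilate (r : ℂ) : PolynomialModule ℂ M →ₗ[ℂ] PolynomialModule ℂ M :=
  PolynomialModule.comp (C r * X)

theorem eval_dilate (r l : ℂ) (p : PolynomialModule ℂ M) :
    (dilate r p).eval l = p.eval (r * l) := by
  rw [dilate, PolynomialModule.comp_eval]
  simp

/-- Dilations act diagonally on coefficients, so a linear relation between dilates of one polynomial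
becomes a numerical condition on each degree that occurs. -/
theorem coeff_dilate (r : ℂ) (p : PolynomialModule ℂ M) (n : ℕ) :
    (dilate r p).coeff n = r ^ n • p.coeff n := by
  induction p using PolynomialModule.induction_linear with
  | zero => simp
  | add p q hp hq => simp only [map_add, PolynomialModule.coeff_add, Finsupp.add_apply, hp, hq,
      smul_add]
  | single k x =>
    rw [dilate, PolynomialModule.comp_single, mul_pow, ← C_pow, C_mul_X_pow_eq_monomial,
      PolynomialModule.monomial_smul_single, PolynomialModule.coeff_single,
      PolynomialModule.coeff_single, add_zero, Finsupp.single_apply, Finsupp.single_apply]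
    split_ifs with h <;> simp [h]

end polynomialModule

namespace LieConformalAlgebra

/-! ### The bracket at a fixed complex number -/

section bracketAt

variable {R : Type*} [AddCommGroup R] [Module ℂ R] [LieConformalAlgebra R]

/-- The `λ`-bracket at the complex number `l`, as a bilinear map. -/
def bracketAt (l : ℂ) : R →ₗ[ℂ] R →ₗ[ℂ] R :=
  bracket.compr₂ (PolynomialModule.eval l)

theorem eval_bracket (l : ℂ) (a b : R) : (bracket a b).eval l = bracketAt l a b := rfl

theorem bracketAt_del_left (l : ℂ) (a b : R) :
    bracketAt l (del a) b = -(l • bracketAt l a b) :=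
  sesq_left l a b

theorem bracketAt_del_right (l : ℂ) (a b : R) :
    bracketAt l a (del b) = del (bracketAt l a b) + l • bracketAt l a b :=
  sesq_right l a b

theorem bracketAt_jacobi (l m : ℂ) (a b c : R) :
    bracketAt l a (bracketAt m b c) =
      bracketAt (l + m) (bracketAt l a b) c + bracketAt m b (bracketAt l a c) :=
  jacobi l m a b c

/-- Iterated sesquilinearity; it reduces compatibility with brackets to the generators. -/
theorem bracketAt_aeval (l : ℂ) (f g : ℂ[X]) (a b : R) :
    bracketAt l (aeval (del : Module.End ℂ R) f a) (aeval (del : Module.End ℂ R) g b) =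
      f.eval (-l) • aeval ((del : Module.End ℂ R) + l • (1 : Module.End ℂ R)) g (bracketAt l a b) := by
  rw [aeval_intertwine (bracketAt l (aeval (del : Module.End ℂ R) f a)) _
    ((del : Module.End ℂ R) + l • (1 : Module.End ℂ R)) (by intro x; simp [bracketAt_del_right])]
  have h := aeval_intertwine ((bracketAt l).flip b) (del : Module.End ℂ R)
    ((-l) • (1 : Module.End ℂ R)) (by intro x; simp [bracketAt_del_left]) f a
  rw [aeval_smul_one] at h
  rw [← map_smul]
  exact congrArg _ h

end bracketAt

/-! ### Homomorphisms and transport of structure -/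

section hom

variable {R S T : Type*} [AddCommGroup R] [Module ℂ R] [LieConformalAlgebra R]
  [AddCommGroup S] [Module ℂ S] [LieConformalAlgebra S]
  [AddCommGroup T] [Module ℂ T] [LieConformalAlgebra T]

theorem Hom.map_bracketAt (f : Hom R S) (l : ℂ) (a b : R) :
    f.toLin (bracketAt l a b) = bracketAt l (f.toLin a) (f.toLin b) := by
  have h := congrArg (PolynomialModule.eval l) (f.map_bracket a b)
  rw [eval_map_linear] at h
  exact h.symm

theorem Hom.map_del' (f : Hom R S) (a : R) : f.toLin (del a) = del (f.toLin a) := f.map_del a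

/-- A linear map that commutes with `∂` and preserves all values of the `λ`-bracket is a
homomorphism. -/
def Hom.ofBracketAt (f : R →ₗ[ℂ] S) (h : ∀ a, f (del a) = del (f a))
    (hb : ∀ l a b, f (bracketAt l a b) = bracketAt l (f a) (f b)) : Hom R S where
  toLin := f
  map_del := h
  map_bracket a b := polynomialModule_ext_eval fun l => by
    rw [eval_map_linear]
    exact (hb l a b).symm

theorem Hom.ext' {f g : Hom R S} (h : ∀ a, f.toLin a = g.toLin a) : f = g := by
  cases f
  cases g
  congr 1
  exact LinearMap.ext h

/-- The identity homomorphism. -/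
def Hom.id (R : Type*) [AddCommGroup R] [Module ℂ R] [LieConformalAlgebra R] : Hom R R :=
  Hom.ofBracketAt LinearMap.id (fun _ => rfl) (fun _ _ _ => rfl)

/-- The composite of two homomorphisms. -/
def Hom.comp (g : Hom S T) (f : Hom R S) : Hom R T :=
  Hom.ofBracketAt (g.toLin.comp f.toLin) (fun a => by simp [Hom.map_del'])
    (fun l a b => by simp [Hom.map_bracketAt])

/-- The structure of a Lie conformal algebra carried over along a linear isomorphism. -/
@[reducible]
def transport {R' : Type*} [AddCommGroup R'] [Module ℂ R'] (e : R ≃ₗ[ℂ] R') :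
    LieConformalAlgebra R' where
  del := e.toLinearMap.comp (del.comp e.symm.toLinearMap)
  bracket := (bracket.compl₁₂ e.symm.toLinearMap e.symm.toLinearMap).compr₂
    (PolynomialModule.map ℂ e.toLinearMap)
  sesq_left l a b := by simp [eval_map_linear, sesq_left]
  sesq_right l a b := by simp [eval_map_linear, sesq_right]
  skew l a b := by
    simp only [LinearMap.compr₂_apply, LinearMap.compl₁₂_apply, eval_map_linear, skew l, map_neg]
    congr 1
    generalize bracket (e.symm.toLinearMap b) (e.symm.toLinearMap a) = p
    induction p using PolynomialModule.induction_linear with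
    | zero => simp
    | add p q hp hq => simp only [map_add, hp, hq]
    | single n x =>
      simp only [PolynomialModule.map_single, substOp_single]
      induction n generalizing x with
      | zero => simp
      | succ n ih => simp [pow_succ, ih, -map_sub]; simp
  jacobi l m a b c := by simp [eval_map_linear, jacobi l m]

end hom

end LieConformalAlgebra

namespace LieConformalAlgebra

/-! ### The cocycle of a central extension of `Block` -/

section cocycle

variable {E : Type*} [AddCommGroup E] [Module ℂ E] [LieConformalAlgebra E]

/-- For lifts `x n` of the generators `J_n`, the deviation of the brackets `[x_i _λ x_j]` from the
brackets of `Block`. -/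
def defect (x : ℕ → E) (i j : ℕ) : PolynomialModule ℂ E :=
  bracket (x i) (x j) - (PolynomialModule.single ℂ 0 (((i : ℂ) + 1) • del (x (i + j))) +
    PolynomialModule.single ℂ 1 (((i : ℂ) + j + 2) • x (i + j)))

theorem bracketAt_eq_defect (x : ℕ → E) (i j : ℕ) (l : ℂ) :
    bracketAt l (x i) (x j) = ((i : ℂ) + 1) • del (x (i + j)) +
      (((i : ℂ) + j + 2) * l) • x (i + j) + (defect x i j).eval l := by
  simp only [defect, map_sub, map_add, PolynomialModule.eval_single, eval_bracket]
  module

theorem _root_.Block.bracketAt_J (i j : ℕ) (l : ℂ) :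
    bracketAt l (Block.J i) (Block.J j) = ((i : ℂ) + 1) • del (Block.J (i + j)) +
      (((i : ℂ) + j + 2) * l) • Block.J (i + j) := by
  have h : bracketAt l (Block.J i) (Block.J j) = (Block.genBracket i j).eval l := by
    change (Block.sesqExt Block.del Block.genBracket (Block.J i) (Block.J j)).eval l = _
    simp [Block.J, Block.eval_sesqExt_single]
  rw [h]
  change _ = ((i : ℂ) + 1) • Block.del (Block.J (i + j)) + _
  simp only [Block.genBracket, map_add, PolynomialModule.eval_single]
  module

variable {π : Hom E Block} {x : ℕ → E}

theorem toLin_eval_defect (hx : ∀ n, π.toLin (x n) = Block.J n) (i j : ℕ) (l : ℂ) :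
    π.toLin ((defect x i j).eval l) = 0 := by
  have h := congrArg π.toLin (bracketAt_eq_defect x i j l)
  rw [Hom.map_bracketAt, hx, hx, Block.bracketAt_J] at h
  simpa [hx, Hom.map_del'] using h

theorem toLin_coeff_defect (hx : ∀ n, π.toLin (x n) = Block.J n) (i j n : ℕ) :
    π.toLin ((defect x i j).coeff n) = 0 := by
  have h : PolynomialModule.map ℂ π.toLin (defect x i j) = 0 :=
    polynomialModule_ext_eval fun l => by rw [eval_map_linear, toLin_eval_defect hx, map_zero]
  rw [← coeff_map_linear, h]
  simp

theorem IsCentralExtension.bracketAt_left (hπ : IsCentralExtension π) {z : E}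
    (hz : π.toLin z = 0) (l : ℂ) (a : E) : bracketAt l z a = 0 := by
  rw [← eval_bracket]
  exact (congrArg _ (hπ.2 z hz a).1).trans (map_zero _)

theorem IsCentralExtension.bracketAt_right (hπ : IsCentralExtension π) {z : E}
    (hz : π.toLin z = 0) (l : ℂ) (a : E) : bracketAt l a z = 0 := by
  rw [← eval_bracket]
  exact (congrArg _ (hπ.2 z hz a).2).trans (map_zero _)

/-- This is the Jacobi identity for `x i`, `x j`, `x k`: inner defects are central and drop out of
outer brackets, and the terms in `x (i + j + k)` cancel as they do in `Block`. -/
theorem defect_cocycle (hπ : IsCentralExtension π) (hx : ∀ n, π.toLin (x n) = Block.J n)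
    (i j k : ℕ) (l m : ℂ) :
    ((j : ℂ) + 1) • del ((defect x i (j + k)).eval l) +
        (((j : ℂ) + 1) * l + ((j : ℂ) + k + 2) * m) • (defect x i (j + k)).eval l =
      (((j : ℂ) + 1) * l - ((i : ℂ) + 1) * m) • (defect x (i + j) k).eval (l + m) +
        (((i : ℂ) + 1) • del ((defect x j (i + k)).eval m) +
          (((i : ℂ) + 1) * m + ((i : ℂ) + k + 2) * l) • (defect x j (i + k)).eval m) := by
  have h := bracketAt_jacobi l m (x i) (x j) (x k)
  rw [bracketAt_eq_defect x j k, bracketAt_eq_defect x i j, bracketAt_eq_defect x i k] at h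
  simp only [map_add, map_smul, LinearMap.add_apply, LinearMap.smul_apply,
    hπ.bracketAt_right (toLin_eval_defect hx _ _ _), hπ.bracketAt_left (toLin_eval_defect hx _ _ _),
    bracketAt_del_right, bracketAt_del_left, bracketAt_eq_defect x i (j + k),
    bracketAt_eq_defect x (i + j) k, bracketAt_eq_defect x j (i + k)] at h
  rw [show j + (i + k) = i + (j + k) by ring, show i + j + k = i + (j + k) by ring] at h
  push_cast at h
  rw [← sub_eq_zero] at h ⊢
  rw [← h]
  module

/-- The cocycle identity at `i = 0`, `l = 0`: bracketing with `x 0` at `0` acts as `∂` up to central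
terms, and the undifferentiated values at `m` cancel. -/
theorem del_eval_defect (hπ : IsCentralExtension π) (hx : ∀ n, π.toLin (x n) = Block.J n)
    (j k : ℕ) (m : ℂ) :
    del ((defect x j k).eval m) = ((j : ℂ) + 1) • del ((defect x 0 (j + k)).eval 0) +
      (((j : ℂ) + k + 2) * m) • (defect x 0 (j + k)).eval 0 := by
  have h := defect_cocycle hπ hx 0 j k 0 m
  simp only [zero_add, Nat.cast_zero, mul_zero, one_mul, zero_sub, one_smul, add_zero] at h
  rw [h]
  module

/-- A central correction leaves the brackets unchanged and moves only the expected right-hand side,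
so the defect changes by a coboundary. -/
theorem defect_add (x t : ℕ → E) (hl : ∀ l n a, bracketAt l (t n) a = 0)
    (hr : ∀ l n a, bracketAt l a (t n) = 0) (i j : ℕ) (l : ℂ) :
    (defect (x + t) i j).eval l = (defect x i j).eval l -
      (((i : ℂ) + 1) • del (t (i + j)) + (((i : ℂ) + j + 2) * l) • t (i + j)) := by
  have h1 := bracketAt_eq_defect (x + t) i j l
  simp only [Pi.add_apply, map_add, LinearMap.add_apply, hl, hr, add_zero,
    bracketAt_eq_defect x i j l] at h1
  rw [← sub_eq_zero] at h1 ⊢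
  rw [← neg_eq_zero, ← h1]
  module

/-- The lifts of the generators can be chosen such that all defects are killed by `∂` and those of
`[x_0 _λ x_n]` have no linear term. -/
theorem exists_normalized_lift (hπ : IsCentralExtension π) :
    ∃ x : ℕ → E, (∀ n, π.toLin (x n) = Block.J n) ∧
      (∀ i j l, del ((defect x i j).eval l) = 0) ∧ ∀ n, (defect x 0 n).coeff 1 = 0 := by
  choose y hy using fun n => hπ.1 (Block.J n)
  -- The coboundary of `t` at `(0, n)` has linear coefficient `(n + 2) t n`, which must equal that
  -- of the defect.
  let t : ℕ → E := fun n => ((n : ℂ) + 2)⁻¹ • (defect y 0 n).coeff 1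
  have hne : ∀ n : ℕ, (n : ℂ) + 2 ≠ 0 := fun n => by
    exact_mod_cast (show n + 2 ≠ 0 by omega)
  have ht : ∀ n, π.toLin (t n) = 0 := fun n => by
    simp [t, toLin_coeff_defect hy]
  have hdt : ∀ n, del (t n) = (defect y 0 n).eval 0 := fun n => by
    -- Comparing linear coefficients here gives `∂ (t n) = d_0n(0)`; then `∂` of the coboundary is
    -- exactly the right side of `del_eval_defect`.
    have h : PolynomialModule.map ℂ del (defect y 0 n) =
        PolynomialModule.single ℂ 0 (del ((defect y 0 n).eval 0)) +
          PolynomialModule.single ℂ 1 (((n : ℂ) + 2) • (defect y 0 n).eval 0) :=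
      polynomialModule_ext_eval fun l => by
        rw [eval_map_linear, del_eval_defect hπ hy]
        simp only [map_add, PolynomialModule.eval_single, zero_add, Nat.cast_zero]
        module
    have h1 := congrArg (fun p => p.coeff 1) h
    simp only [coeff_map_linear, PolynomialModule.coeff_add, PolynomialModule.coeff_single,
      Finsupp.add_apply, Finsupp.single_apply] at h1
    simp [t, h1, smul_smul, inv_mul_cancel₀ (hne n)]
  have hd : ∀ i j l, (defect (y + t) i j).eval l = (defect y i j).eval l -
      (((i : ℂ) + 1) • del (t (i + j)) + (((i : ℂ) + j + 2) * l) • t (i + j)) :=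
    defect_add y t (fun l n a => hπ.bracketAt_left (ht n) l a)
      (fun l n a => hπ.bracketAt_right (ht n) l a)
  refine ⟨y + t, fun n => by simp [hy, ht], fun i j l => ?_, fun n => ?_⟩
  · rw [hd, map_sub, del_eval_defect hπ hy]
    simp only [map_add, map_smul, hdt, sub_self]
  · have h : defect (y + t) 0 n = defect y 0 n - (PolynomialModule.single ℂ 0 (del (t n)) +
          PolynomialModule.single ℂ 1 (((n : ℂ) + 2) • t n)) :=
      polynomialModule_ext_eval fun l => by
        rw [hd]
        simp only [map_sub, map_add, PolynomialModule.eval_single, zero_add, Nat.cast_zero]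
        module
    have hs : ((n : ℂ) + 2) • t n = (defect y 0 n).coeff 1 := by
      simp [t, smul_smul, mul_inv_cancel₀ (hne n)]
    rw [h, hs, sub_eq_add_neg, PolynomialModule.coeff_add]
    have hneg : ∀ p : PolynomialModule ℂ E, (-p).coeff 1 = -p.coeff 1 := fun p => by
      rw [← neg_one_smul ℂ, coeff_smul_polynomialModule, neg_one_smul]
    rw [Finsupp.add_apply, hneg, PolynomialModule.coeff_add]
    simp

/-! ### Normalized cocycles vanish except for the cubic term -/

section normalized

variable (hπ : IsCentralExtension π) (hx : ∀ n, π.toLin (x n) = Block.J n)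
  (hd : ∀ i j l, del ((defect x i j).eval l) = 0)

include hπ hx hd

theorem eval_zero_defect_zero (n : ℕ) : (defect x 0 n).eval 0 = 0 := by
  have h := del_eval_defect hπ hx 0 n 1
  rw [hd, zero_add, hd, smul_zero, zero_add, eq_comm, smul_eq_zero] at h
  refine h.resolve_left ?_
  simp only [Nat.cast_zero, zero_add, mul_one]
  exact_mod_cast (show n + 2 ≠ 0 by omega)

theorem defect_eq_defect_zero (j k : ℕ) : defect x j k = defect x 0 (j + k) := by
  have hj : (j : ℂ) + 1 ≠ 0 := by exact_mod_cast (show j + 1 ≠ 0 by omega)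
  have h : ((j : ℂ) + 1) • defect x 0 (j + k) = ((j : ℂ) + 1) • defect x j k +
      PolynomialModule.single ℂ 0 (((k : ℂ) + 2) • (defect x j k).eval 0) :=
    -- The cocycle identity for `(0, j, k)` at `m = 0` is `l` times the claim; evaluating the claim
    -- at `0` then forces the constant term to vanish.
    polynomialModule_ext_smul_eval fun l => by
      have h := defect_cocycle hπ hx 0 j k l 0
      simp only [zero_add, hd, smul_zero, add_zero, Nat.cast_zero, mul_zero, sub_zero] at h
      rw [← sub_eq_zero] at h ⊢
      rw [← h]
      simp only [map_add, map_smul, PolynomialModule.eval_single]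
      module
  have h0 : (defect x j k).eval 0 = 0 := by
    have h1 := congrArg (PolynomialModule.eval 0) h
    simp only [map_add, map_smul, PolynomialModule.eval_single, pow_zero, one_smul,
      eval_zero_defect_zero hπ hx hd, smul_zero] at h1
    rw [← add_smul, eq_comm, smul_eq_zero] at h1
    refine h1.resolve_left ?_
    exact_mod_cast (show (j + 1) + (k + 2) ≠ 0 by omega)
  rw [h0, smul_zero, PolynomialModule.single_zero, add_zero] at h
  exact (smul_right_injective _ hj h).symm

/-- Since `n + 1 > 0`, the triple `(0, 1, n)` is available besides `(0, 0, n + 1)`. At `m = l` it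
gives `p(2l) = 2p(l)`, which allows only degree one, and the normalization excludes that. -/
theorem defect_zero_succ_eq_zero (hc : ∀ n, (defect x 0 n).coeff 1 = 0) (n : ℕ) :
    defect x 0 (n + 1) = 0 := by
  have h : dilate 2 (defect x 0 (n + 1)) = (2 : ℂ) • defect x 0 (n + 1) :=
    polynomialModule_ext_smul_eval fun l => by
      have h0 := defect_cocycle hπ hx 0 0 (n + 1) l l
      have h1 := defect_cocycle hπ hx 0 1 n l l
      rw [defect_eq_defect_zero hπ hx hd (0 + 1), defect_eq_defect_zero hπ hx hd 1] at h1
      simp only [zero_add, hd, smul_zero, Nat.cast_zero, add_comm 1 n, ← two_mul] at h0 h1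
      push_cast at h0 h1
      rw [map_smul, eval_dilate]
      rw [← sub_eq_zero] at h0 h1 ⊢
      rw [← sub_eq_zero.mpr (h0.trans h1.symm)]
      module
  ext k
  have hk := congrArg (fun p => p.coeff k) h
  simp only [coeff_dilate, coeff_smul_polynomialModule] at hk
  rw [← sub_eq_zero, ← sub_smul, smul_eq_zero] at hk
  rcases eq_or_ne k 1 with rfl | hk1
  · simp [hc]
  · refine hk.resolve_left fun h2 => hk1 ?_
    have h3 : (2 : ℕ) ^ k = 2 ^ 1 := by exact_mod_cast sub_eq_zero.mp h2
    exact Nat.pow_right_injective le_rfl h3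

/-- Degree `k` can occur only if `3 ^ k + 5 = 4 * 2 ^ k`, that is, for `k = 1` or `k = 3`; the
normalization removes `k = 1`. -/
theorem defect_zero_zero (hc : ∀ n, (defect x 0 n).coeff 1 = 0) :
    defect x 0 0 = PolynomialModule.single ℂ 3 ((defect x 0 0).coeff 3) := by
  have h : dilate 3 (defect x 0 0) + (5 : ℂ) • defect x 0 0 =
      (4 : ℂ) • dilate 2 (defect x 0 0) :=
    polynomialModule_ext_smul_eval fun l => by
      -- At `m = l` the identity is a tautology, so the next ratio is taken.
      have h0 := defect_cocycle hπ hx 0 0 0 l (2 * l)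
      simp only [zero_add, hd, smul_zero, Nat.cast_zero, show l + 2 * l = 3 * l by ring] at h0
      simp only [map_add, map_smul, eval_dilate]
      rw [← sub_eq_zero] at h0 ⊢
      rw [← h0]
      module
  ext k
  have hk := congrArg (fun p => p.coeff k) h
  simp only [PolynomialModule.coeff_add, Finsupp.add_apply, coeff_dilate,
    coeff_smul_polynomialModule] at hk
  rw [smul_smul, ← add_smul, ← sub_eq_zero, ← sub_smul, smul_eq_zero] at hk
  rw [PolynomialModule.coeff_single, Finsupp.single_apply]
  split_ifs with h3
  · rw [h3]
  rcases eq_or_ne k 1 with rfl | hk1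
  · exact hc 0
  refine hk.resolve_left fun h2 => ?_
  have h4 : (3 : ℕ) ^ k + 5 = 4 * 2 ^ k := by exact_mod_cast sub_eq_zero.mp h2
  have hlt : ∀ m : ℕ, 4 * 2 ^ (m + 4) < 3 ^ (m + 4) := fun m => by
    induction m with
    | zero => norm_num
    | succ m ih => rw [show m + 1 + 4 = (m + 4) + 1 by ring, pow_succ 2 (m + 4), pow_succ 3 (m + 4)]; omega
  match k, h3, hk1, h4 with
  | 0, _, _, h4 => norm_num at h4
  | 1, _, hk1, _ => exact hk1 rfl
  | 2, _, _, h4 => norm_num at h4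
  | 3, h3, _, _ => exact h3 rfl
  | m + 4, _, _, h4 => have := hlt m; linarith

end normalized

/-- In every central extension of `Block` the generators have lifts whose brackets are those of
`BlockExt`, for some central element `κ` in place of `𝔠`. -/
theorem exists_lift_bracketAt (hπ : IsCentralExtension π) :
    ∃ (x : ℕ → E) (κ : E), (∀ n, π.toLin (x n) = Block.J n) ∧ π.toLin κ = 0 ∧ del κ = 0 ∧
      ∀ i j l, bracketAt l (x i) (x j) = ((i : ℂ) + 1) • del (x (i + j)) +
        (((i : ℂ) + j + 2) * l) • x (i + j) + if i = 0 ∧ j = 0 then l ^ 3 • κ else 0 := by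
  obtain ⟨x, hx, hd, hc⟩ := exists_normalized_lift hπ
  refine ⟨x, (defect x 0 0).coeff 3, hx, toLin_coeff_defect hx _ _ _, ?_, fun i j l => ?_⟩
  · have h : PolynomialModule.map ℂ del (defect x 0 0) = 0 :=
      polynomialModule_ext_eval fun l => by rw [eval_map_linear, hd, map_zero]
    rw [← coeff_map_linear, h]
    simp
  · rw [bracketAt_eq_defect x i j]
    congr 1
    split_ifs with h
    · obtain ⟨rfl, rfl⟩ := h
      conv_lhs => rw [defect_zero_zero hπ hx hd hc]
      rw [PolynomialModule.eval_single]
    · obtain ⟨n, hn⟩ : ∃ n, i + j = n + 1 := ⟨i + j - 1, by omega⟩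
      rw [defect_eq_defect_zero hπ hx hd, hn, defect_zero_succ_eq_zero hπ hx hd hc, map_zero]

end cocycle

end LieConformalAlgebra

/-! ### The extension `BlockExt`: brackets, kernel, nontriviality -/

namespace BlockExt

open LieConformalAlgebra

theorem bracketAt_apply (l : ℂ) (a b : BlockExt) :
    bracketAt l a b = (bracketAt l a.1 b.1, coc l a.1 b.1) :=
  BlockExt.eval_bracket l a b

theorem bracketAt_J (i j : ℕ) (l : ℂ) :
    bracketAt l (J i) (J j) =
      ((i : ℂ) + 1) • (LieConformalAlgebra.del : Module.End ℂ BlockExt) (J (i + j)) +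
      (((i : ℂ) + j + 2) * l) • J (i + j) + if i = 0 ∧ j = 0 then l ^ 3 • c else 0 := by
  rw [bracketAt_apply]
  refine Prod.ext ?_ ?_
  · change bracketAt l (Block.J i) (Block.J j) = _
    rw [Block.bracketAt_J]
    change _ = ((i : ℂ) + 1) • LieConformalAlgebra.del (Block.J (i + j)) +
      (((i : ℂ) + j + 2) * l) • Block.J (i + j) +
      (if i = 0 ∧ j = 0 then l ^ 3 • c else (0 : BlockExt)).1
    split_ifs <;> simp [c]
  · change coc l (Finsupp.single i 1) (Finsupp.single j 1) =
      ((i : ℂ) + 1) * 0 + (((i : ℂ) + j + 2) * l) * 0 +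
      (if i = 0 ∧ j = 0 then l ^ 3 • c else (0 : BlockExt)).2
    rw [coc_single]
    split_ifs <;> simp [c]

theorem bracket_J (i j : ℕ) :
    lamBracket (J i) (J j) = PolynomialModule.single ℂ 0 (((i : ℂ) + 1) • partialD (J (i + j))) +
      PolynomialModule.single ℂ 1 (((i : ℂ) + j + 2) • J (i + j)) +
      if i = 0 ∧ j = 0 then PolynomialModule.single ℂ 3 c else 0 :=
  polynomialModule_ext_eval fun l => by
    rw [LieConformalAlgebra.eval_bracket, bracketAt_J]
    split_ifs <;> simp only [map_add, map_zero, PolynomialModule.eval_single] <;> module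

theorem isCentralExtension_proj : IsCentralExtension proj := by
  refine ⟨fun a => ⟨(a, 0), rfl⟩, fun z hz a => ?_⟩
  have hz' : z.1 = 0 := hz
  constructor <;> refine polynomialModule_ext_eval fun l => ?_ <;>
    rw [LieConformalAlgebra.eval_bracket, bracketAt_apply, hz'] <;> simp

theorem ker_proj : LinearMap.ker proj.toLin = Submodule.span ℂ {c} := by
  ext z
  rw [LinearMap.mem_ker, Submodule.mem_span_singleton]
  constructor
  · intro h
    exact ⟨z.2, Prod.ext (by simpa [c] using (show z.1 = 0 from h).symm) (by simp [c])⟩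
  · rintro ⟨s, rfl⟩
    simp [c, proj]

theorem aeval_del_J (i : ℕ) (f : ℂ[X]) :
    aeval (LieConformalAlgebra.del : Module.End ℂ BlockExt) f (J i) = (Finsupp.single i f, 0) := by
  have h1 := aeval_fst 0 f (J i)
  have h2 := aeval_snd 0 f (J i)
  rw [zero_smul, add_zero] at h1 h2
  have h3 := Block.aeval_del 0 f 1 i
  rw [zero_smul, add_zero] at h1 h3
  refine Prod.ext (h1.trans (h3.trans ?_)) (h2.trans ?_)
  · simp
  · simp [J]

/-- `BlockExt` is spanned by `𝔠` and the elements `f(∂)J_i`. -/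
theorem linearMap_ext {N : Type*} [AddCommGroup N] [Module ℂ N] {φ ψ : BlockExt →ₗ[ℂ] N}
    (hJ : ∀ i f, φ (Finsupp.single i f, 0) = ψ (Finsupp.single i f, 0)) (hc : φ c = ψ c) :
    φ = ψ := by
  refine LinearMap.prod_ext (LinearMap.ext fun a => Block.lin_ext (fun i f => ?_) a)
    (LinearMap.ext_ring hc)
  exact hJ i f

/-- A section changes `J 0` by a multiple of `𝔠`, which alters the scalar part of its bracket only
by a linear term in `l`; this cannot cancel `l ^ 3`, as `l = 1` and `l = 2` show. -/
theorem not_isTrivialExtension_proj : ¬ IsTrivialExtension proj := by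
  rintro ⟨s, hs⟩
  have h : ∀ l : ℂ, l ^ 3 = 2 * l * (s.toLin (Block.J 0)).2 := fun l => by
    have h1 := s.map_bracketAt l (Block.J 0) (Block.J 0)
    have h2 : (s.toLin (Block.J 0)).1 = Block.J 0 := hs _
    rw [Block.bracketAt_J, bracketAt_apply, h2, map_add, map_smul, map_smul, Hom.map_del'] at h1
    have h3 := congrArg Prod.snd h1
    change (((0 : ℕ) : ℂ) + 1) * 0 + ((((0 : ℕ) : ℂ) + (0 : ℕ) + 2) * l) *
      (s.toLin (Block.J 0)).2 = coc l (Finsupp.single 0 1) (Finsupp.single 0 1) at h3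
    rw [coc_single] at h3
    simpa using h3.symm
  have h1 := h 1
  have h2 := h 2
  have : (6 : ℂ) = 0 := by linear_combination h2 - 2 * h1
  norm_num at this

/-! ### Universality of `BlockExt` -/

section desc

variable {E : Type*} [AddCommGroup E] [Module ℂ E] [LieConformalAlgebra E]
  {π : Hom E Block}

/-- The linear map `f(∂)J_i ↦ f(∂)x_i`, `𝔠 ↦ κ`. -/
def descLin (x : ℕ → E) (κ : E) : BlockExt →ₗ[ℂ] E :=
  LinearMap.coprod
    (Finsupp.lsum ℂ fun i => (LinearMap.applyₗ (x i)).comp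
      (aeval (LieConformalAlgebra.del : Module.End ℂ E)).toLinearMap)
    (LinearMap.toSpanSingleton ℂ E κ)

theorem descLin_single (x : ℕ → E) (κ : E) (i : ℕ) (f : ℂ[X]) :
    descLin x κ (Finsupp.single i f, 0) =
      aeval (LieConformalAlgebra.del : Module.End ℂ E) f (x i) := by
  simp [descLin]

theorem descLin_J (x : ℕ → E) (κ : E) (i : ℕ) : descLin x κ (J i) = x i := by
  rw [J, Block.J, descLin_single]
  simp

theorem descLin_c (x : ℕ → E) (κ : E) : descLin x κ c = κ := by
  simp [descLin, c]

theorem descLin_del (x : ℕ → E) {κ : E} (hκ : LieConformalAlgebra.del κ = 0) (a : BlockExt) :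
    descLin x κ ((LieConformalAlgebra.del : Module.End ℂ BlockExt) a) =
      LieConformalAlgebra.del (descLin x κ a) := by
  suffices h : (descLin x κ).comp LieConformalAlgebra.del =
      LieConformalAlgebra.del.comp (descLin x κ) from LinearMap.congr_fun h a
  refine linearMap_ext (fun i f => ?_) ?_
  · change descLin x κ (Block.del (Finsupp.single i f), 0) = _
    rw [Block.del_single, descLin_single, LinearMap.comp_apply, descLin_single, map_mul, aeval_X]
    rfl
  · change descLin x κ (Block.del 0, 0) = _
    rw [LinearMap.comp_apply, descLin_c, hκ, map_zero]
    exact map_zero (descLin x κ)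

/-- Sesquilinearity reduces this to the generators, where the two sets of relations coincide; pairs
involving `𝔠` vanish on both sides because `𝔠` and `κ` are central. -/
theorem descLin_bracketAt (hπ : IsCentralExtension π) {x : ℕ → E} {κ : E}
    (hκ : π.toLin κ = 0) (hdκ : LieConformalAlgebra.del κ = 0)
    (hb : ∀ i j l, bracketAt l (x i) (x j) =
      ((i : ℂ) + 1) • LieConformalAlgebra.del (x (i + j)) +
        (((i : ℂ) + j + 2) * l) • x (i + j) + if i = 0 ∧ j = 0 then l ^ 3 • κ else 0)
    (l : ℂ) (a b : BlockExt) :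
    descLin x κ (bracketAt l a b) = bracketAt l (descLin x κ a) (descLin x κ b) := by
  have hc : ∀ a : BlockExt, bracketAt l a c = 0 ∧ bracketAt l c a = 0 := fun a =>
    ⟨isCentralExtension_proj.bracketAt_right rfl l a,
      isCentralExtension_proj.bracketAt_left rfl l a⟩
  suffices h : (bracketAt l).compr₂ (descLin x κ) =
      (bracketAt l).compl₁₂ (descLin x κ) (descLin x κ) from LinearMap.congr_fun₂ h a b
  refine linearMap_ext (fun i f => linearMap_ext (fun j g => ?_) ?_) (LinearMap.ext fun b => ?_)
  · rw [LinearMap.compr₂_apply, LinearMap.compl₁₂_apply, descLin_single, descLin_single,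
      bracketAt_aeval, ← aeval_del_J, ← aeval_del_J, bracketAt_aeval, map_smul,
      aeval_intertwine (descLin x κ) _
        ((LieConformalAlgebra.del : Module.End ℂ E) + l • (1 : Module.End ℂ E))
        (by intro y; simp [descLin_del x hdκ]), hb, bracketAt_J]
    congr 2
    simp only [map_add, map_smul, descLin_del x hdκ, descLin_J]
    split_ifs
    · rw [map_smul, descLin_c]
    · rw [map_zero]
  · simp [hc, descLin_c, hπ.bracketAt_right hκ]
  · simp [hc, descLin_c, hπ.bracketAt_left hκ]

theorem exists_hom (hπ : IsCentralExtension π) :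
    ∃ f : Hom BlockExt E, ∀ a, π.toLin (f.toLin a) = proj.toLin a := by
  obtain ⟨x, κ, hx, hκ, hdκ, hb⟩ := exists_lift_bracketAt hπ
  refine ⟨Hom.ofBracketAt (descLin x κ) (descLin_del x hdκ)
    (descLin_bracketAt hπ hκ hdκ hb), fun a => ?_⟩
  suffices h : π.toLin.comp (descLin x κ) = proj.toLin from LinearMap.congr_fun h a
  refine linearMap_ext (fun i f => ?_) ?_
  · rw [← aeval_del_J, LinearMap.comp_apply, aeval_intertwine (descLin x κ) _ _
      (descLin_del x hdκ), aeval_intertwine π.toLin _ _ π.map_del',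
      aeval_intertwine proj.toLin _ _ proj.map_del', descLin_J, hx]
    rfl
  · rw [LinearMap.comp_apply, descLin_c, hκ]
    rfl

/-- The difference has central values, so it kills every bracket. The brackets of `J 0` with `J n`,
taken at several `l`, already yield `𝔠` and all `J n`. -/
theorem hom_unique (hπ : IsCentralExtension π) {f g : Hom BlockExt E}
    (hf : ∀ a, π.toLin (f.toLin a) = proj.toLin a)
    (hg : ∀ a, π.toLin (g.toLin a) = proj.toLin a) : f = g := by
  have hz : ∀ a, π.toLin (f.toLin a - g.toLin a) = 0 := fun a => by rw [map_sub, hf, hg, sub_self]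
  let h : BlockExt →ₗ[ℂ] E := f.toLin - g.toLin
  have hdel : ∀ a, h ((LieConformalAlgebra.del : Module.End ℂ BlockExt) a) =
      LieConformalAlgebra.del (h a) := fun a => by
    simp only [h, LinearMap.sub_apply, map_sub, f.map_del', g.map_del']
  have hb : ∀ l a b, h (bracketAt l a b) = 0 := fun l a b => by
    have e : bracketAt l (f.toLin a) (f.toLin b) = bracketAt l (g.toLin a) (g.toLin b) := by
      rw [← sub_eq_zero, ← add_sub_cancel (g.toLin a) (f.toLin a),
        ← add_sub_cancel (g.toLin b) (f.toLin b), map_add (bracketAt l), LinearMap.add_apply,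
        map_add, map_add, hπ.bracketAt_left (hz a), hπ.bracketAt_left (hz a),
        hπ.bracketAt_right (hz b)]
      simp
    simp [h, Hom.map_bracketAt, e]
  have hJ : ∀ (n : ℕ) (l : ℂ), h ((LieConformalAlgebra.del : Module.End ℂ BlockExt) (J n)) + (((n : ℂ) + 2) * l) • h (J n) +
      (if n = 0 then l ^ 3 • h c else 0) = 0 := fun n l => by
    have e := hb l (J 0) (J n)
    rw [bracketAt_J] at e
    rw [← e]
    split_ifs <;> simp_all
  have h00 : ∀ n, h ((LieConformalAlgebra.del : Module.End ℂ BlockExt) (J n)) = 0 := fun n => by simpa using hJ n 0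
  have hc0 : h c = 0 := by
    have e1 := hJ 0 1
    have e2 := hJ 0 2
    simp only [h00, Nat.cast_zero, if_true] at e1 e2
    have e3 : (6 : ℂ) • h c = 0 := by
      -- Value at `l = 2` minus twice the value at `l = 1`: the linear term cancels and `8 - 2 = 6`
      -- remains.
      have e4 : (6 : ℂ) • h c = (0 + ((0 + 2) * 2 : ℂ) • h (J 0) + (2 : ℂ) ^ 3 • h c) -
          (2 : ℂ) • (0 + ((0 + 2) * 1 : ℂ) • h (J 0) + (1 : ℂ) ^ 3 • h c) := by module
      rw [e4, e1, e2, smul_zero, sub_zero]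
    simpa using e3
  have hJ0 : ∀ n, h (J n) = 0 := fun n => by
    have e := hJ n 1
    simp only [h00, hc0, smul_zero, ite_self, add_zero, zero_add, mul_one, smul_eq_zero] at e
    exact e.resolve_left (by exact_mod_cast (show n + 2 ≠ 0 by omega))
  have h0 : h = 0 := linearMap_ext (fun i p => by
    rw [← aeval_del_J, aeval_intertwine h _ _ hdel, hJ0]; simp) (by simp [hc0])
  exact Hom.ext' fun a => sub_eq_zero.mp (LinearMap.congr_fun h0 a)

theorem isUniversalCentralExtension_proj :
    IsUniversalCentralExtension.{u, 0, 0} proj := by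
  refine ⟨isCentralExtension_proj, fun E' _ _ _ π' hπ' => ?_⟩
  obtain ⟨f, hf⟩ := exists_hom hπ'
  exact ⟨f, hf, fun g hg => hom_unique hπ' hg hf⟩

/-! ### Uniqueness of the extension -/

theorem isTrivialExtension_of_map_c_eq_zero {f : Hom BlockExt E}
    (hf : ∀ a, π.toLin (f.toLin a) = proj.toLin a) (hc : f.toLin c = 0) :
    IsTrivialExtension π := by
  -- Thus `f` factors through `Block`, and the factor is the section.
  have hs : ∀ (a : Block) (s : ℂ), f.toLin (a, s) = f.toLin (a, 0) := fun a s => by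
    have e : ((a, s) : BlockExt) = (a, 0) + s • c := by simp [c]
    rw [e, map_add, map_smul, hc, smul_zero, add_zero]
  refine ⟨Hom.ofBracketAt (f.toLin.comp (LinearMap.inl ℂ Block ℂ)) (fun a => ?_)
    (fun l a b => ?_), fun a => ?_⟩
  · exact f.map_del' (a, 0)
  · have e := f.map_bracketAt l (a, 0) (b, 0)
    rw [bracketAt_apply, hs] at e
    exact e
  · exact hf (a, 0)

/-- Nontriviality forces the image of `𝔠` to be nonzero, so the homomorphism over `Block` maps one
kernel line isomorphically onto the other. -/
theorem extensionIso_of_finrank_ker (hπ : IsCentralExtension π) (ht : ¬ IsTrivialExtension π)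
    (hr : Module.finrank ℂ (LinearMap.ker π.toLin) = 1) : ExtensionIso proj π := by
  obtain ⟨f, hf⟩ := exists_hom hπ
  have hc : f.toLin c ≠ 0 := fun hc => ht (isTrivialExtension_of_map_c_eq_zero hf hc)
  have hk : π.toLin (f.toLin c) = 0 := hf c
  refine ⟨f, ⟨?_, fun y => ?_⟩, hf⟩
  · rw [injective_iff_map_eq_zero]
    intro a ha
    have h1 : a ∈ LinearMap.ker proj.toLin := by rw [LinearMap.mem_ker, ← hf, ha, map_zero]
    rw [ker_proj, Submodule.mem_span_singleton] at h1
    obtain ⟨s, rfl⟩ := h1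
    rw [map_smul, smul_eq_zero] at ha
    rw [ha.resolve_right hc, zero_smul]
  · have h1 : y - f.toLin (π.toLin y, 0) ∈ LinearMap.ker π.toLin := by
      rw [LinearMap.mem_ker, map_sub, hf]
      exact sub_self _
    obtain ⟨s, hs⟩ := exists_smul_eq_of_finrank_eq_one hr
      (x := ⟨f.toLin c, hk⟩) (fun h => hc (congrArg Subtype.val h)) ⟨_, h1⟩
    have hs' : s • f.toLin c = y - f.toLin (π.toLin y, 0) := congrArg Subtype.val hs
    exact ⟨(π.toLin y, 0) + s • c, by rw [map_add, map_smul, hs', add_sub_cancel]⟩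

end desc

theorem extensionIso_of_isUniversalCentralExtension {E : Type u} [AddCommGroup E] [Module ℂ E]
    [LieConformalAlgebra E] {π : Hom E Block} (hπ : IsUniversalCentralExtension.{u, u, 0} π) :
    ExtensionIso proj π := by
  obtain ⟨f, hf⟩ := exists_hom hπ.1
  -- The universal property of `E` tests only extensions in universe `u`, so a copy of `BlockExt` is
  -- placed there.
  let e : BlockExt ≃ₗ[ℂ] ULift.{u} BlockExt := ULift.moduleEquiv.symm
  let _ : LieConformalAlgebra (ULift.{u} BlockExt) := transport e
  have hbr : ∀ l a b, bracketAt l a b = e (bracketAt l (e.symm a) (e.symm b)) := fun l a b =>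
    eval_map_linear e.toLinearMap l (bracket (e.symm a) (e.symm b))
  let d : Hom (ULift.{u} BlockExt) BlockExt := Hom.ofBracketAt e.symm.toLinearMap
    (fun a => rfl) (fun l a b => by rw [hbr]; simp)
  have hd : IsCentralExtension (proj.comp d) := by
    refine ⟨isCentralExtension_proj.1.comp e.symm.surjective, fun z hz a => ?_⟩
    constructor <;> refine polynomialModule_ext_eval fun l => ?_ <;>
      rw [LieConformalAlgebra.eval_bracket, hbr]
    · rw [isCentralExtension_proj.bracketAt_left (z := e.symm z) hz, map_zero, map_zero]
    · rw [isCentralExtension_proj.bracketAt_right (z := e.symm z) hz, map_zero, map_zero]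
  obtain ⟨g, hg, -⟩ := hπ.2 _ _ hd
  -- Both composites are endomorphisms over `Block`, hence identities by the two uniqueness
  -- statements.
  have h1 : (d.comp g).comp f = Hom.id BlockExt :=
    hom_unique isCentralExtension_proj (fun a => (hg _).trans (hf a)) (fun a => rfl)
  have h2 : f.comp (d.comp g) = Hom.id E :=
    (hπ.2 E π hπ.1).unique (fun a => (hf _).trans (hg a)) (fun a => rfl)
  refine ⟨f, Function.bijective_iff_has_inverse.mpr ⟨(d.comp g).toLin, fun a => ?_, fun a => ?_⟩,
    hf⟩
  · exact congrArg (fun k : Hom BlockExt BlockExt => k.toLin a) h1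
  · exact congrArg (fun k : Hom E E => k.toLin a) h2

end BlockExt

end

theorem mainTheorem4 :
    -- the projection of `BlockExt = Block ⊕ ℂ𝔠` onto `Block` is a nontrivial universal central
    -- extension, with kernel `ℂ𝔠`
    LieConformalAlgebra.IsUniversalCentralExtension.{u, 0, 0} BlockExt.proj ∧
    ¬ LieConformalAlgebra.IsTrivialExtension BlockExt.proj ∧
    LinearMap.ker BlockExt.proj.toLin = Submodule.span ℂ {BlockExt.c} ∧
    BlockExt.c ≠ 0 ∧
    LieConformalAlgebra.partialD BlockExt.c = 0 ∧
    (∀ i : ℕ, BlockExt.proj.toLin (BlockExt.J i) = Block.J i) ∧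
    -- `[J_0 _λ J_0] = (∂ + 2λ) J_0 + λ³ 𝔠`
    LieConformalAlgebra.lamBracket (BlockExt.J 0) (BlockExt.J 0) =
      PolynomialModule.single ℂ 0 (LieConformalAlgebra.partialD (BlockExt.J 0)) +
        PolynomialModule.single ℂ 1 ((2 : ℂ) • BlockExt.J 0) +
        PolynomialModule.single ℂ 3 BlockExt.c ∧
    -- `[J_i _λ J_j] = ((i+1)∂ + (i+j+2)λ) J_{i+j}` for all other `i`, `j`
    (∀ i j : ℕ, (i, j) ≠ (0, 0) →
      LieConformalAlgebra.lamBracket (BlockExt.J i) (BlockExt.J j) =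
        PolynomialModule.single ℂ 0
            (((i : ℂ) + 1) • LieConformalAlgebra.partialD (BlockExt.J (i + j))) +
          PolynomialModule.single ℂ 1 (((i : ℂ) + j + 2) • BlockExt.J (i + j))) ∧
    -- every universal central extension of `Block` is isomorphic to this one
    (∀ (E : Type u) [AddCommGroup E] [Module ℂ E] [LieConformalAlgebra E]
      (π : LieConformalAlgebra.Hom E Block),
      LieConformalAlgebra.IsUniversalCentralExtension.{u, u, 0} π →
        LieConformalAlgebra.ExtensionIso BlockExt.proj π) ∧
    -- every nontrivial central extension of `Block` with one-dimensional kernel is isomorphic to it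
    (∀ (E : Type u) [AddCommGroup E] [Module ℂ E] [LieConformalAlgebra E]
      (π : LieConformalAlgebra.Hom E Block),
      LieConformalAlgebra.IsCentralExtension π →
      ¬ LieConformalAlgebra.IsTrivialExtension π →
      Module.finrank ℂ (LinearMap.ker π.toLin) = 1 →
        LieConformalAlgebra.ExtensionIso BlockExt.proj π) := by

  refine ⟨BlockExt.isUniversalCentralExtension_proj, BlockExt.not_isTrivialExtension_proj,
    BlockExt.ker_proj, ?_, ?_, fun _ => rfl, ?_, fun i j hij => ?_,
    fun E _ _ _ π hπ => BlockExt.extensionIso_of_isUniversalCentralExtension hπ,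
    fun E _ _ _ π hπ ht hr => BlockExt.extensionIso_of_finrank_ker hπ ht hr⟩
  · exact fun h => one_ne_zero (congrArg Prod.snd h : (1 : ℂ) = 0)
  · exact Prod.ext (map_zero Block.del) rfl
  · simpa using BlockExt.bracket_J 0 0
  · rw [BlockExt.bracket_J, if_neg (fun h => hij (Prod.ext h.1 h.2)), add_zero]
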